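/- Let $k$ be a field and let $H$ be a finite-dimensional ribbon Hopf algebra over $k$, with coproduct $\Delta(h)=\sum h_{(1)}\otimes h_{(2)}$, counit $\varepsilon$ and (invertible) antipode $S$. Let $H\text{-Bimod}$ be the category of finite-dimensional $H$-bimodules, with the tensor product $X\otimes Y=X\otimes_k Y$ on which $H$ acts through the coproduct on both sides, $h\cdot(x\otimes y)=\sum h_{(1)}\cdot x\otimes h_{(2)}\cdot y$ and $(x\otimes y)\cdot h=\sum x\cdot h_{(1)}\otimes y\cdot h_{(2)}$, with unit object $(k,\varepsilon,\varepsilon)$, and with the right duals $X^\vee=X^*$, $(h\cdot\varphi)(x)=\varphi(S(h)\cdot x)$, $(\varphi\cdot h)(x)=\varphi(x\cdot S^{-1}(h))$, whose evaluation and coevaluation are those of vector spaces. Let the coadjoint bimodule $K$ be the vector space $H^*\otimes_k H^*$ with the coadjoint left action on the first factor, $h\cdot(p\otimes q)=(h\triangleright p)\otimes q$, $(h\triangleright p)(a)=\sum p\big(S(h_{(1)})\,a\,h_{(2)}\big)$, and with the coadjoint right action on the second factor, $(p\otimes q)\cdot h=p\otimes(q\triangleleft h)$, $(q\triangleleft h)(b)=\sum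 q\big(h_{(2)}\,b\,S^{-1}(h_{(1)})\big)$. For a bimodule $X$ let $$i_X\colon X^\vee\otimes X\to K,\qquad i_X(\varphi\otimes x)=\sum_{m,n}\varphi(e_m\cdot x\cdot e_n)\; e^m\otimes e^n ,$$ where $(e_m)$ is a basis of $H$ and $(e^m)$ the dual basis of $H^*$; that is, $i_X(\varphi\otimes x)$ is the functional $a\otimes b\mapsto\varphi(a\cdot x\cdot b)$. Then every $i_X$ is a morphism of $H$-bimodules, the family $i=(i_X)_X$ is dinatural for the functor $\otimes\circ(?^\vee\times \mathrm{Id})\colon H\text{-Bimod}^{\mathrm{op}}\times H\text{-Bimod}\to H\text{-Bimod}$, $(X,Y)\mapsto X^\vee\otimes Y$, and $(K,i)$ is the coend of this functor: $$(K,i)=\int^{X\in H\text{-Bimod}} X^\vee\otimes X .$$ Consequently, for every coend $(K',i')$ of this functor (Lyubashenko's object for $H\text{-Bimod}$) there is exactly one isomorphism $e\colon K\to K'$ with $e\circ i_X=i'_X$ for all $X$. -/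

import Mathlib

open TensorProduct CategoryTheory

universe u

/-- A quasitriangular structure on a Hopf algebra: an invertible `R` in `H ⊗ H` with
`Δ^op(h) R = R Δ(h)`, `(Δ ⊗ id)(R) = R₁₃ R₂₃` and `(id ⊗ Δ)(R) = R₁₃ R₁₂`, the last two written
in `H ⊗ (H ⊗ H)`. -/
class QuasitriangularHopf (k H : Type*) [Field k] [Ring H] [HopfAlgebra k H] where
  R : (H ⊗[k] H)ˣ
  comm_comul_mul : ∀ h : H, TensorProduct.comm k H H (Coalgebra.comul h) * (R : H ⊗[k] H) =
    (R : H ⊗[k] H) * Coalgebra.comul h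
  comul_rTensor : TensorProduct.assoc k H H H
      ((Coalgebra.comul : H →ₗ[k] H ⊗[k] H).rTensor H (R : H ⊗[k] H)) =
    Algebra.TensorProduct.map (AlgHom.id k H)
        (Algebra.TensorProduct.includeRight : H →ₐ[k] H ⊗[k] H) (R : H ⊗[k] H) *
      (1 : H) ⊗ₜ[k] (R : H ⊗[k] H)
  comul_lTensor : (Coalgebra.comul : H →ₗ[k] H ⊗[k] H).lTensor H (R : H ⊗[k] H) =
    Algebra.TensorProduct.map (AlgHom.id k H)
        (Algebra.TensorProduct.includeRight : H →ₐ[k] H ⊗[k] H) (R : H ⊗[k] H) *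
      Algebra.TensorProduct.map (AlgHom.id k H)
        (Algebra.TensorProduct.includeLeft : H →ₐ[k] H ⊗[k] H) (R : H ⊗[k] H)

namespace QuasitriangularHopf
variable {k H : Type*} [Field k] [Ring H] [HopfAlgebra k H]
open HopfAlgebra

lemma counit_rmatrix [QuasitriangularHopf k H] :
    (Coalgebra.counit : H →ₗ[k] k).lTensor H (R : (H ⊗[k] H)ˣ) = 1 ⊗ₜ 1 := by
  have key := congrArg ((((Coalgebra.counit : H →ₗ[k] k).rTensor H)).lTensor H)
    (comul_lTensor (k := k) (H := H))
  have h1 : ∀ r : H ⊗[k] H, ((((Coalgebra.counit : H →ₗ[k] k).rTensor H)).lTensor H)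
      ((Coalgebra.comul : H →ₗ[k] H ⊗[k] H).lTensor H r) =
      Algebra.TensorProduct.map (AlgHom.id k H)
        (Algebra.TensorProduct.includeRight : H →ₐ[k] k ⊗[k] H) r := by
    intro r
    induction r with
    | zero => simp
    | add x y hx hy => simp only [map_add, hx, hy]
    | tmul x y => simp
  have h2 : ∀ r s : H ⊗[k] H, ((((Coalgebra.counit : H →ₗ[k] k).rTensor H)).lTensor H)
      (Algebra.TensorProduct.map (AlgHom.id k H)
        (Algebra.TensorProduct.includeRight : H →ₐ[k] H ⊗[k] H) r *
      Algebra.TensorProduct.map (AlgHom.id k H)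
        (Algebra.TensorProduct.includeLeft : H →ₐ[k] H ⊗[k] H) s) =
      Algebra.TensorProduct.map (AlgHom.id k H)
        (Algebra.TensorProduct.includeRight : H →ₐ[k] k ⊗[k] H) (r *
          Algebra.TensorProduct.includeLeft (S := k) (R := k) (B := H)
          (TensorProduct.rid k H ((Coalgebra.counit : H →ₗ[k] k).lTensor H s))) := by
    intro r s
    induction r with
    | zero => simp
    | add x y hx hy => simp only [map_add, add_mul, hx, hy]
    | tmul x y =>
      induction s with
      | zero => simp
      | add x y hx hy => simp only [map_add, mul_add, hx, hy]
      | tmul a b =>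
        simp only [Algebra.TensorProduct.map_tmul, AlgHom.coe_id, id_eq,
          Algebra.TensorProduct.includeRight_apply, Algebra.TensorProduct.includeLeft_apply,
          Algebra.TensorProduct.tmul_mul_tmul, one_mul, mul_one, LinearMap.lTensor_tmul,
          LinearMap.rTensor_tmul, TensorProduct.rid_tmul, mul_smul_comm]
        rw [TensorProduct.smul_tmul, TensorProduct.smul_tmul', smul_eq_mul, mul_one]
  rw [h1, h2] at key
  have inj : Function.Injective (Algebra.TensorProduct.map (AlgHom.id k H)
        (Algebra.TensorProduct.includeRight : H →ₐ[k] k ⊗[k] H)) := by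
    have : ∀ r, TensorProduct.map LinearMap.id (TensorProduct.lid k H).toLinearMap
        (Algebra.TensorProduct.map (AlgHom.id k H)
        (Algebra.TensorProduct.includeRight : H →ₐ[k] k ⊗[k] H) r) = r := by
      intro r
      induction r with
      | zero => simp
      | add x y hx hy => simp only [map_add, hx, hy]
      | tmul x y => simp
    exact Function.LeftInverse.injective this
  have k2 := inj key
  have k3 := (Units.isUnit _).mul_left_cancel (k2.symm.trans (mul_one _).symm)
  have k4 := congrArg (fun t => (TensorProduct.rid k H).symm (TensorProduct.rid k H ((Coalgebra.counit : H →ₗ[k] k).lTensor H t))) k3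
  simpa [Algebra.TensorProduct.one_def] using k4

/-- The linear map `x ⊗ y ↦ S(y) x`. -/
noncomputable def drinfeldMap (k H : Type*) [Field k] [Ring H] [HopfAlgebra k H] :
    H ⊗[k] H →ₗ[k] H :=
  LinearMap.mul' k H ∘ₗ (antipode k (A := H)).rTensor H ∘ₗ (TensorProduct.comm k H H).toLinearMap

lemma drinfeldMap_mul (s : H ⊗[k] H) (x y : H) :
    drinfeldMap k H (s * x ⊗ₜ y) = antipode k y * drinfeldMap k H s * x := by
  induction s with
  | zero => simp
  | add a b ha hb => simp only [map_add, add_mul, mul_add, ha, hb]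
  | tmul a b => simp [drinfeldMap, antipode_mul_antidistrib, mul_assoc]

lemma drinfeldMap_comm_comul_mul (w : H) (t : H ⊗[k] H) :
    drinfeldMap k H (TensorProduct.comm k H H (Coalgebra.comul w) * t) =
      Coalgebra.counit (R := k) w • drinfeldMap k H t := by
  induction t with
  | zero => simp
  | add a b ha hb => simp only [map_add, mul_add, ha, hb, smul_add]
  | tmul a b =>
    rw [drinfeldMap_mul]
    have : drinfeldMap k H (TensorProduct.comm k H H (Coalgebra.comul w)) =
        algebraMap k H (Coalgebra.counit w) := by
      simp [drinfeldMap, TensorProduct.comm_comm]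
    rw [this]
    simp [drinfeldMap, Algebra.algebraMap_eq_smul_one]

/-- `S²(h) u = u h` for the Drinfeld element `u`. -/
lemma antipode_sq_mul [QuasitriangularHopf k H] (h : H) :
    antipode k (antipode k h) * drinfeldMap k H (R : (H ⊗[k] H)ˣ) =
      drinfeldMap k H (R : (H ⊗[k] H)ˣ) * h := by
  set r : H ⊗[k] H := ((R : (H ⊗[k] H)ˣ) : H ⊗[k] H) with hr
  set u := drinfeldMap k H r with hu
  let S : H →ₗ[k] H := antipode k
  let M : H ⊗[k] H →ₗ[k] H := LinearMap.mul' k H ∘ₗ (TensorProduct.comm k H H).toLinearMap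
  -- `s ⊗ z ↦ S²(z) N(r s)` and `s ⊗ z ↦ S²(z) N(s^op r)`
  let L : (H ⊗[k] H) ⊗[k] H →ₗ[k] H :=
    M ∘ₗ TensorProduct.map (drinfeldMap k H ∘ₗ LinearMap.mulLeft k r) (S ∘ₗ S)
  let L' : (H ⊗[k] H) ⊗[k] H →ₗ[k] H :=
    M ∘ₗ TensorProduct.map (drinfeldMap k H ∘ₗ LinearMap.mulRight k r ∘ₗ
      (TensorProduct.comm k H H).toLinearMap) (S ∘ₗ S)
  have e1 : ∀ t : H ⊗[k] H, L ((Coalgebra.comul : H →ₗ[k] H ⊗[k] H).rTensor H t) =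
      L' ((Coalgebra.comul : H →ₗ[k] H ⊗[k] H).rTensor H t) := by
    intro t
    induction t with
    | zero => simp
    | add a b ha hb => simp only [map_add, ha, hb]
    | tmul a b => simp [L, L', comm_comul_mul, hr]
  have e2 : ∀ t : H ⊗[k] H, L' ((Coalgebra.comul : H →ₗ[k] H ⊗[k] H).rTensor H t) =
      S (S (TensorProduct.lid k H ((Coalgebra.counit : H →ₗ[k] k).rTensor H t))) * u := by
    intro t
    induction t with
    | zero => simp
    | add a b ha hb => simp only [map_add, ha, hb, add_mul]
    | tmul a b => simp [L', M, drinfeldMap_comm_comul_mul, hu]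
  have e3 : ∀ t : H ⊗[k] H, L ((TensorProduct.assoc k H H H).symm
        ((Coalgebra.comul : H →ₗ[k] H ⊗[k] H).lTensor H t)) =
      u * (TensorProduct.rid k H ((Coalgebra.counit : H →ₗ[k] k).lTensor H t)) := by
    intro t
    induction t with
    | zero => simp
    | add a b ha hb => simp only [map_add, ha, hb, mul_add]
    | tmul a b =>
      have : ∀ q : H ⊗[k] H, L ((TensorProduct.assoc k H H H).symm (a ⊗ₜ q)) =
          S (LinearMap.mul' k H (S.lTensor H q)) * (u * a) := by
        intro q
        induction q with
        | zero => simp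
        | add a b ha hb => simp only [TensorProduct.tmul_add, map_add, ha, hb, add_mul]
        | tmul y z => 
          simp [L, M, drinfeldMap_mul, S, antipode_mul_antidistrib, mul_assoc, hu]
      simp [this, S, Algebra.algebraMap_eq_smul_one]
  have f1 := e1 (Coalgebra.comul h)
  rw [e2, ← Coalgebra.coassoc_symm_apply, e3] at f1
  simpa [S] using f1.symm

lemma exists_mul_drinfeld_eq_one [QuasitriangularHopf k H] :
    ∃ w : H, w * drinfeldMap k H (R : (H ⊗[k] H)ˣ) = 1 := by
  let S : H →ₗ[k] H := antipode k
  let T : H ⊗[k] (H ⊗[k] H) →ₗ[k] H := LinearMap.mul' k H ∘ₗ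
    (TensorProduct.comm k H H).toLinearMap ∘ₗ
      (LinearMap.mul' k H ∘ₗ S.lTensor H).lTensor H
  let W : H ⊗[k] H →ₗ[k] H := LinearMap.mul' k H ∘ₗ (TensorProduct.comm k H H).toLinearMap ∘ₗ
    (S ∘ₗ S).rTensor H
  have h1 : ∀ t : H ⊗[k] H, T ((Coalgebra.comul : H →ₗ[k] H ⊗[k] H).lTensor H t) =
      TensorProduct.rid k H ((Coalgebra.counit : H →ₗ[k] k).lTensor H t) := by
    intro t
    induction t with
    | zero => simp
    | add a b ha hb => simp only [map_add, ha, hb]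
    | tmul a b => simp [T, S, Algebra.algebraMap_eq_smul_one]
  have h2 : ∀ (t : H ⊗[k] H) (a b : H), T (Algebra.TensorProduct.map (AlgHom.id k H)
        (Algebra.TensorProduct.includeRight : H →ₐ[k] H ⊗[k] H) t * a ⊗ₜ (b ⊗ₜ 1)) =
      b * (drinfeldMap k H t * a) := by
    intro t a b
    induction t with
    | zero => simp
    | add x y hx hy => simp only [map_add, add_mul, mul_add, hx, hy]
    | tmul x y => simp [T, S, drinfeldMap, mul_assoc]
  have h3 : ∀ t : H ⊗[k] H, T (Algebra.TensorProduct.map (AlgHom.id k H)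
        (Algebra.TensorProduct.includeRight : H →ₐ[k] H ⊗[k] H) (R : (H ⊗[k] H)ˣ) *
        Algebra.TensorProduct.map (AlgHom.id k H)
        (Algebra.TensorProduct.includeLeft : H →ₐ[k] H ⊗[k] H) t) =
      W t * drinfeldMap k H (R : (H ⊗[k] H)ˣ) := by
    intro t
    induction t with
    | zero => simp
    | add x y hx hy => simp only [map_add, add_mul, mul_add, hx, hy]
    | tmul x y =>
      simp only [Algebra.TensorProduct.map_tmul, AlgHom.coe_id, id_eq,
        Algebra.TensorProduct.includeLeft_apply, h2, ← antipode_sq_mul]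
      simp [W, S, mul_assoc]
  refine ⟨W (R : (H ⊗[k] H)ˣ), ?_⟩
  rw [← h3, ← comul_lTensor, h1, counit_rmatrix]
  simp

lemma antipode_injective [QuasitriangularHopf k H] :
    Function.Injective (antipode k (A := H)) := by
  rw [injective_iff_map_eq_zero]
  intro h hh
  obtain ⟨w, hw⟩ := exists_mul_drinfeld_eq_one (k := k) (H := H)
  have := antipode_sq_mul (k := k) h
  rw [hh, map_zero, zero_mul] at this
  rw [← one_mul h, ← hw, mul_assoc, ← this, mul_zero]

end QuasitriangularHopf

namespace QuasitriangularHopf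
variable {k H : Type*} [Field k] [Ring H] [HopfAlgebra k H]
open HopfAlgebra

/-- The monodromy matrix `Q = R₂₁ · R`. -/
def monodromy [QuasitriangularHopf k H] : (H ⊗[k] H)ˣ :=
  Units.map (Algebra.TensorProduct.comm k H H : H ⊗[k] H →* H ⊗[k] H) R * R

/-- The antipode of a finite-dimensional quasitriangular Hopf algebra, as a linear
automorphism; `(antipodeEquiv k H).symm` is the inverse antipode. -/
noncomputable def antipodeEquiv (k H : Type*) [Field k] [Ring H] [HopfAlgebra k H]
    [FiniteDimensional k H] [QuasitriangularHopf k H] : H ≃ₗ[k] H :=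
  LinearEquiv.ofInjectiveEndo (antipode k) antipode_injective

@[simp]
lemma antipodeEquiv_apply [FiniteDimensional k H] [QuasitriangularHopf k H] (h : H) :
    antipodeEquiv k H h = antipode k h := rfl

@[simp]
lemma antipodeEquiv_symm_antipode [FiniteDimensional k H] [QuasitriangularHopf k H] (h : H) :
    (antipodeEquiv k H).symm (antipode k h) = h :=
  (antipodeEquiv k H).symm_apply_apply h

lemma antipodeEquiv_symm_one [FiniteDimensional k H] [QuasitriangularHopf k H] :
    (antipodeEquiv k H).symm 1 = 1 := by
  rw [LinearEquiv.symm_apply_eq]; simp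

lemma antipodeEquiv_symm_mul [FiniteDimensional k H] [QuasitriangularHopf k H] (g h : H) :
    (antipodeEquiv k H).symm (g * h) =
      (antipodeEquiv k H).symm h * (antipodeEquiv k H).symm g := by
  rw [LinearEquiv.symm_apply_eq, antipodeEquiv_apply, antipode_mul_antidistrib,
    ← antipodeEquiv_apply, ← antipodeEquiv_apply, LinearEquiv.apply_symm_apply,
    LinearEquiv.apply_symm_apply]

end QuasitriangularHopf

/-- A ribbon Hopf algebra: a quasitriangular Hopf algebra with a central invertible element
`v` such that `S(v) = v`, `ε(v) = 1` and `Δ(v) = (v ⊗ v) Q⁻¹`. -/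
class RibbonHopf (k H : Type*) [Field k] [Ring H] [HopfAlgebra k H] extends
    QuasitriangularHopf k H where
  v : Hˣ
  v_central : ∀ h : H, (v : H) * h = h * v
  antipode_v : HopfAlgebra.antipode k (v : H) = v
  counit_v : Coalgebra.counit (R := k) (v : H) = 1
  comul_v : Coalgebra.comul (R := k) (v : H) =
    ((v : H) ⊗ₜ[k] (v : H)) * ((QuasitriangularHopf.monodromy (k := k) (H := H))⁻¹ : (H ⊗[k] H)ˣ)

/-- A finite-dimensional `H`-bimodule: a finite-dimensional vector space with a left action
`lact h x = h · x` and a right action `ract h x = x · h` that commute. -/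
structure HBimod (k H : Type u) [Field k] [Ring H] [HopfAlgebra k H] where
  V : Type u
  [addCommGroup : AddCommGroup V]
  [module : Module k V]
  [finite : FiniteDimensional k V]
  lact : H →ₗ[k] V →ₗ[k] V
  ract : H →ₗ[k] V →ₗ[k] V
  lact_one : lact 1 = LinearMap.id
  lact_mul : ∀ g h, lact (g * h) = lact g ∘ₗ lact h
  ract_one : ract 1 = LinearMap.id
  ract_mul : ∀ g h, ract (g * h) = ract h ∘ₗ ract g
  lact_ract : ∀ g h, lact g ∘ₗ ract h = ract h ∘ₗ lact g

attribute [instance] HBimod.addCommGroup HBimod.module HBimod.finite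

namespace HBimod

section Actions

variable {k H : Type u} [Field k] [Ring H] [HopfAlgebra k H]
variable {V W Z V' W' : Type u} [AddCommGroup V] [Module k V] [AddCommGroup W] [Module k W]
  [AddCommGroup Z] [Module k Z] [AddCommGroup V'] [Module k V'] [AddCommGroup W'] [Module k W']

/-- `a ⊗ b` acts on `V ⊗ W` as `ρ a ⊗ σ b`. -/
noncomputable def tensorAct₂ (ρ : H →ₗ[k] V →ₗ[k] V) (σ : H →ₗ[k] W →ₗ[k] W) :
    H ⊗[k] H →ₗ[k] (V ⊗[k] W) →ₗ[k] V ⊗[k] W :=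
  TensorProduct.homTensorHomMap (RingHom.id k) V W V W ∘ₗ TensorProduct.map ρ σ

/-- `h` acts on `V ⊗ W` as `∑ ρ h₍₁₎ ⊗ σ h₍₂₎`. -/
noncomputable def tensorAct (ρ : H →ₗ[k] V →ₗ[k] V) (σ : H →ₗ[k] W →ₗ[k] W) :
    H →ₗ[k] (V ⊗[k] W) →ₗ[k] V ⊗[k] W :=
  tensorAct₂ ρ σ ∘ₗ Coalgebra.comul

@[simp]
lemma tensorAct₂_tmul (ρ : H →ₗ[k] V →ₗ[k] V) (σ : H →ₗ[k] W →ₗ[k] W) (a b : H) :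
    tensorAct₂ ρ σ (a ⊗ₜ b) = TensorProduct.map (ρ a) (σ b) := rfl

lemma tensorAct_one {ρ : H →ₗ[k] V →ₗ[k] V} {σ : H →ₗ[k] W →ₗ[k] W}
    (hρ : ρ 1 = LinearMap.id) (hσ : σ 1 = LinearMap.id) :
    tensorAct ρ σ 1 = LinearMap.id := by
  simp [tensorAct, Algebra.TensorProduct.one_def, hρ, hσ]

lemma tensorAct_mul {ρ : H →ₗ[k] V →ₗ[k] V} {σ : H →ₗ[k] W →ₗ[k] W}
    (hρ : ∀ g h, ρ (g * h) = ρ g ∘ₗ ρ h) (hσ : ∀ g h, σ (g * h) = σ g ∘ₗ σ h) (g h : H) :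
    tensorAct ρ σ (g * h) = tensorAct ρ σ g ∘ₗ tensorAct ρ σ h := by
  have : ∀ s t : H ⊗[k] H, tensorAct₂ ρ σ (s * t) = tensorAct₂ ρ σ s ∘ₗ tensorAct₂ ρ σ t := by
    intro s t
    induction s with
    | zero => simp
    | add a b ha hb => simp only [map_add, add_mul, ha, hb, LinearMap.add_comp]
    | tmul a b =>
      induction t with
      | zero => simp
      | add x y hx hy => simp only [map_add, mul_add, hx, hy, LinearMap.comp_add]
      | tmul x y => simp [hρ, hσ, TensorProduct.map_comp]
  simp [tensorAct, Bialgebra.comul_mul, this]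

lemma tensorAct_mul_op {ρ : H →ₗ[k] V →ₗ[k] V} {σ : H →ₗ[k] W →ₗ[k] W}
    (hρ : ∀ g h, ρ (g * h) = ρ h ∘ₗ ρ g) (hσ : ∀ g h, σ (g * h) = σ h ∘ₗ σ g) (g h : H) :
    tensorAct ρ σ (g * h) = tensorAct ρ σ h ∘ₗ tensorAct ρ σ g := by
  have : ∀ s t : H ⊗[k] H, tensorAct₂ ρ σ (s * t) = tensorAct₂ ρ σ t ∘ₗ tensorAct₂ ρ σ s := by
    intro s t
    induction s with
    | zero => simp
    | add a b ha hb => simp only [map_add, add_mul, ha, hb, LinearMap.comp_add]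
    | tmul a b =>
      induction t with
      | zero => simp
      | add x y hx hy => simp only [map_add, mul_add, hx, hy, LinearMap.add_comp]
      | tmul x y => simp [hρ, hσ, TensorProduct.map_comp]
  simp [tensorAct, Bialgebra.comul_mul, this]

lemma tensorAct_comm {ρ ρ' : H →ₗ[k] V →ₗ[k] V} {σ σ' : H →ₗ[k] W →ₗ[k] W}
    (hρ : ∀ g h, ρ g ∘ₗ ρ' h = ρ' h ∘ₗ ρ g) (hσ : ∀ g h, σ g ∘ₗ σ' h = σ' h ∘ₗ σ g) (g h : H) :
    tensorAct ρ σ g ∘ₗ tensorAct ρ' σ' h = tensorAct ρ' σ' h ∘ₗ tensorAct ρ σ g := by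
  have : ∀ s t : H ⊗[k] H, tensorAct₂ ρ σ s ∘ₗ tensorAct₂ ρ' σ' t =
      tensorAct₂ ρ' σ' t ∘ₗ tensorAct₂ ρ σ s := by
    intro s t
    induction s with
    | zero => simp
    | add a b ha hb => simp only [map_add, ha, hb, LinearMap.comp_add, LinearMap.add_comp]
    | tmul a b =>
      induction t with
      | zero => simp
      | add x y hx hy => simp only [map_add, hx, hy, LinearMap.add_comp, LinearMap.comp_add]
      | tmul x y => simp [hρ, hσ, ← TensorProduct.map_comp]
  simp [tensorAct, this]

lemma map_tensorAct {ρ : H →ₗ[k] V →ₗ[k] V} {σ : H →ₗ[k] W →ₗ[k] W}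
    {ρ' : H →ₗ[k] V' →ₗ[k] V'} {σ' : H →ₗ[k] W' →ₗ[k] W'} {f : V →ₗ[k] V'} {g : W →ₗ[k] W'}
    (hf : ∀ h, f ∘ₗ ρ h = ρ' h ∘ₗ f) (hg : ∀ h, g ∘ₗ σ h = σ' h ∘ₗ g) (h : H) :
    TensorProduct.map f g ∘ₗ tensorAct ρ σ h = tensorAct ρ' σ' h ∘ₗ TensorProduct.map f g := by
  have : ∀ s : H ⊗[k] H, TensorProduct.map f g ∘ₗ tensorAct₂ ρ σ s =
      tensorAct₂ ρ' σ' s ∘ₗ TensorProduct.map f g := by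
    intro s
    induction s with
    | zero => simp
    | add a b ha hb => simp only [map_add, ha, hb, LinearMap.comp_add, LinearMap.add_comp]
    | tmul a b => simp [hf, hg, ← TensorProduct.map_comp]
  simp [tensorAct, this]

lemma assoc_tensorAct (ρ : H →ₗ[k] V →ₗ[k] V) (σ : H →ₗ[k] W →ₗ[k] W)
    (τ : H →ₗ[k] Z →ₗ[k] Z) (h : H) :
    (TensorProduct.assoc k V W Z).toLinearMap ∘ₗ tensorAct (tensorAct ρ σ) τ h =
      tensorAct ρ (tensorAct σ τ) h ∘ₗ (TensorProduct.assoc k V W Z).toLinearMap := by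
  ext v w z
  let Θ : H ⊗[k] (H ⊗[k] H) →ₗ[k] V ⊗[k] (W ⊗[k] Z) :=
    TensorProduct.map (ρ.flip v) (TensorProduct.map (σ.flip w) (τ.flip z))
  have h1 : ∀ s : H ⊗[k] H, TensorProduct.assoc k V W Z
      (tensorAct₂ (tensorAct ρ σ) τ s ((v ⊗ₜ w) ⊗ₜ z)) =
      Θ (TensorProduct.assoc k H H H (Coalgebra.comul.rTensor H s)) := by
    intro s
    induction s with
    | zero => simp
    | add a b ha hb => simp only [map_add, LinearMap.add_apply, ha, hb]
    | tmul a b =>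
      have : ∀ t : H ⊗[k] H, TensorProduct.assoc k V W Z
          ((tensorAct₂ ρ σ t (v ⊗ₜ w)) ⊗ₜ τ b z) =
          Θ (TensorProduct.assoc k H H H (t ⊗ₜ b)) := by
        intro t
        induction t with
        | zero => simp
        | add a b ha hb =>
          simp only [map_add, LinearMap.add_apply, TensorProduct.add_tmul, ha, hb]
        | tmul a b => simp [Θ]
      simpa [tensorAct] using this (Coalgebra.comul a)
  have h2 : ∀ s : H ⊗[k] H, tensorAct₂ ρ (tensorAct σ τ) s (v ⊗ₜ (w ⊗ₜ z)) =
      Θ (Coalgebra.comul.lTensor H s) := by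
    intro s
    induction s with
    | zero => simp
    | add a b ha hb => simp only [map_add, LinearMap.add_apply, ha, hb]
    | tmul a b =>
      have : ∀ t : H ⊗[k] H, (ρ a v) ⊗ₜ[k] (tensorAct₂ σ τ t (w ⊗ₜ z)) = Θ (a ⊗ₜ t) := by
        intro t
        induction t with
        | zero => simp
        | add a b ha hb =>
          simp only [map_add, LinearMap.add_apply, TensorProduct.tmul_add, ha, hb]
        | tmul a b => simp [Θ]
      simpa [tensorAct] using this (Coalgebra.comul b)
  have := h1 (Coalgebra.comul h)
  rw [Coalgebra.coassoc_apply, ← h2] at this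
  simpa [tensorAct] using this

/-- `h` acts on the ground field by `ε(h)`. -/
noncomputable def trivAct (k H : Type u) [Field k] [Ring H] [HopfAlgebra k H] :
    H →ₗ[k] k →ₗ[k] k :=
  LinearMap.lsmul k k ∘ₗ Coalgebra.counit

lemma lid_tensorAct (ρ : H →ₗ[k] V →ₗ[k] V) (h : H) :
    (TensorProduct.lid k V).toLinearMap ∘ₗ tensorAct (trivAct k H) ρ h =
      ρ h ∘ₗ (TensorProduct.lid k V).toLinearMap := by
  have : ∀ s : H ⊗[k] H, (TensorProduct.lid k V).toLinearMap ∘ₗ tensorAct₂ (trivAct k H) ρ s =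
      ρ (TensorProduct.lid k H ((Coalgebra.counit : H →ₗ[k] k).rTensor H s)) ∘ₗ
        (TensorProduct.lid k V).toLinearMap := by
    intro s
    induction s with
    | zero => simp
    | add a b ha hb => simp only [map_add, ha, hb, LinearMap.comp_add, LinearMap.add_comp]
    | tmul a b => ext v; simp [trivAct]
  simpa [tensorAct] using this (Coalgebra.comul h)

lemma rid_tensorAct (ρ : H →ₗ[k] V →ₗ[k] V) (h : H) :
    (TensorProduct.rid k V).toLinearMap ∘ₗ tensorAct ρ (trivAct k H) h =
      ρ h ∘ₗ (TensorProduct.rid k V).toLinearMap := by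
  have : ∀ s : H ⊗[k] H, (TensorProduct.rid k V).toLinearMap ∘ₗ tensorAct₂ ρ (trivAct k H) s =
      ρ (TensorProduct.rid k H ((Coalgebra.counit : H →ₗ[k] k).lTensor H s)) ∘ₗ
        (TensorProduct.rid k V).toLinearMap := by
    intro s
    induction s with
    | zero => simp
    | add a b ha hb => simp only [map_add, ha, hb, LinearMap.comp_add, LinearMap.add_comp]
    | tmul a b => ext v; simp [trivAct]
  simpa [tensorAct] using this (Coalgebra.comul h)

/-- `h` acts on `V*` by precomposition with `ρ (T h)`. -/
noncomputable def dualAct (T : H →ₗ[k] H) (ρ : H →ₗ[k] V →ₗ[k] V) :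
    H →ₗ[k] Module.Dual k V →ₗ[k] Module.Dual k V :=
  Module.Dual.transpose ∘ₗ ρ ∘ₗ T

@[simp]
lemma dualAct_apply (T : H →ₗ[k] H) (ρ : H →ₗ[k] V →ₗ[k] V) (h : H) (φ : Module.Dual k V) :
    dualAct T ρ h φ = φ ∘ₗ ρ (T h) := rfl

lemma contractLeft_tensorAct (T : H →ₗ[k] H) (ρ : H →ₗ[k] V →ₗ[k] V)
    (hT : ∀ h, TensorProduct.lift ((LinearMap.llcomp k V V V).compl₁₂ (ρ ∘ₗ T) ρ)
      (Coalgebra.comul h) = Coalgebra.counit (R := k) h • LinearMap.id) (h : H) :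
    contractLeft k V ∘ₗ tensorAct (dualAct T ρ) ρ h = trivAct k H h ∘ₗ contractLeft k V := by
  ext φ v
  have : ∀ s : H ⊗[k] H, contractLeft k V (tensorAct₂ (dualAct T ρ) ρ s (φ ⊗ₜ v)) =
      φ (TensorProduct.lift ((LinearMap.llcomp k V V V).compl₁₂ (ρ ∘ₗ T) ρ) s v) := by
    intro s
    induction s with
    | zero => simp
    | add a b ha hb => simp only [map_add, ha, hb, LinearMap.add_apply]
    | tmul a b => simp
  simpa [tensorAct, hT, trivAct] using this (Coalgebra.comul h)

lemma tensorAct_coevaluation [FiniteDimensional k V] (T : H →ₗ[k] H) (ρ : H →ₗ[k] V →ₗ[k] V)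
    (hT : ∀ h, TensorProduct.lift ((LinearMap.llcomp k V V V).compl₁₂ ρ (ρ ∘ₗ T))
      (Coalgebra.comul h) = Coalgebra.counit (R := k) h • LinearMap.id) (h : H) :
    coevaluation k V ∘ₗ trivAct k H h = tensorAct ρ (dualAct T ρ) h ∘ₗ coevaluation k V := by
  apply LinearMap.ext_ring
  let D : V ⊗[k] Module.Dual k V →ₗ[k] V →ₗ[k] V :=
    dualTensorHom k V V ∘ₗ (TensorProduct.comm k _ _).toLinearMap
  have Dinj : Function.Injective D :=
    (dualTensorHomEquiv k V V).injective.comp (TensorProduct.comm k _ _).injective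
  have D1 : D (coevaluation k V 1) = LinearMap.id := by
    ext v
    simp only [coevaluation_apply_one, map_sum, D, LinearMap.sum_apply]
    simpa [dualTensorHom_apply] using (Module.Basis.ofVectorSpace k V).sum_repr v
  have D2 : ∀ (s : H ⊗[k] H) (t : V ⊗[k] Module.Dual k V), D t = LinearMap.id →
      D (tensorAct₂ ρ (dualAct T ρ) s t) =
      TensorProduct.lift ((LinearMap.llcomp k V V V).compl₁₂ ρ (ρ ∘ₗ T)) s := by
    intro s t ht
    induction s with
    | zero => simp
    | add a b ha hb => simp only [map_add, ha, hb, LinearMap.add_apply]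
    | tmul a b =>
      have : D (tensorAct₂ ρ (dualAct T ρ) (a ⊗ₜ b) t) = ρ a ∘ₗ D t ∘ₗ ρ (T b) := by
        clear ht
        induction t with
        | zero => simp
        | add a b ha hb => simp only [map_add, ha, hb, LinearMap.comp_add, LinearMap.add_comp]
        | tmul v φ => ext x; simp [D, dualTensorHom_apply]
      rw [this, ht]
      ext x; simp
  apply Dinj
  have := D2 (Coalgebra.comul h) _ D1
  simp only [LinearMap.comp_apply, tensorAct, this, hT]
  simp only [trivAct, LinearMap.comp_apply, LinearMap.lsmul_apply, map_smul, D1]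

end Actions

variable {k H : Type u} [Field k] [Ring H] [HopfAlgebra k H]

/-- Bimodule morphisms: linear maps commuting with both actions. -/
@[ext]
structure Hom (X Y : HBimod.{u} k H) where
  lin : X.V →ₗ[k] Y.V
  lin_lact : ∀ h, lin ∘ₗ X.lact h = Y.lact h ∘ₗ lin
  lin_ract : ∀ h, lin ∘ₗ X.ract h = Y.ract h ∘ₗ lin

instance : Category (HBimod.{u} k H) where
  Hom X Y := Hom X Y
  id X := ⟨LinearMap.id, fun _ => rfl, fun _ => rfl⟩
  comp f g := ⟨g.lin ∘ₗ f.lin,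
    fun h => by rw [LinearMap.comp_assoc, f.lin_lact, ← LinearMap.comp_assoc, g.lin_lact,
      LinearMap.comp_assoc],
    fun h => by rw [LinearMap.comp_assoc, f.lin_ract, ← LinearMap.comp_assoc, g.lin_ract,
      LinearMap.comp_assoc]⟩

@[ext]
lemma hom_ext {X Y : HBimod.{u} k H} {f g : X ⟶ Y} (h : f.lin = g.lin) : f = g :=
  Hom.ext h

@[simp] lemma id_lin (X : HBimod.{u} k H) : Hom.lin (𝟙 X) = LinearMap.id := rfl
@[simp] lemma comp_lin {X Y Z : HBimod.{u} k H} (f : X ⟶ Y) (g : Y ⟶ Z) :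
    Hom.lin (f ≫ g) = g.lin ∘ₗ f.lin := rfl

/-- A linear isomorphism that commutes with both actions is an isomorphism of bimodules. -/
def mkIso {X Y : HBimod.{u} k H} (e : X.V ≃ₗ[k] Y.V)
    (hl : ∀ h, e.toLinearMap ∘ₗ X.lact h = Y.lact h ∘ₗ e.toLinearMap)
    (hr : ∀ h, e.toLinearMap ∘ₗ X.ract h = Y.ract h ∘ₗ e.toLinearMap) : X ≅ Y where
  hom := ⟨e.toLinearMap, hl, hr⟩
  inv := ⟨e.symm.toLinearMap,
    fun h => by
      ext y; apply e.injective
      simpa using (LinearMap.congr_fun (hl h) (e.symm y)).symm,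
    fun h => by
      ext y; apply e.injective
      simpa using (LinearMap.congr_fun (hr h) (e.symm y)).symm⟩
  hom_inv_id := by ext x; exact e.symm_apply_apply x
  inv_hom_id := by ext x; exact e.apply_symm_apply x

/-- The tensor product over `k`, with `H` acting from both sides through the coproduct. -/
@[simps lact ract]
noncomputable def tensor (X Y : HBimod.{u} k H) : HBimod.{u} k H where
  V := X.V ⊗[k] Y.V
  lact := tensorAct X.lact Y.lact
  ract := tensorAct X.ract Y.ract
  lact_one := tensorAct_one X.lact_one Y.lact_one
  lact_mul := tensorAct_mul X.lact_mul Y.lact_mul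
  ract_one := tensorAct_one X.ract_one Y.ract_one
  ract_mul := tensorAct_mul_op X.ract_mul Y.ract_mul
  lact_ract := tensorAct_comm X.lact_ract Y.lact_ract

/-- The ground field, with both actions through the counit. -/
@[simps lact ract]
noncomputable def unit (k H : Type u) [Field k] [Ring H] [HopfAlgebra k H] : HBimod.{u} k H where
  V := k
  lact := trivAct k H
  ract := trivAct k H
  lact_one := by ext; simp [trivAct]
  lact_mul g h := by ext; simp [trivAct]
  ract_one := by ext; simp [trivAct]
  ract_mul g h := by ext; simp [trivAct, mul_comm]
  lact_ract g h := by ext; simp [trivAct, mul_comm]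

/-- The tensor product of bimodule morphisms. -/
noncomputable def tensorHom {X Y X' Y' : HBimod.{u} k H} (f : X ⟶ X') (g : Y ⟶ Y') :
    tensor X Y ⟶ tensor X' Y' :=
  ⟨TensorProduct.map f.lin g.lin, map_tensorAct f.lin_lact g.lin_lact,
    map_tensorAct f.lin_ract g.lin_ract⟩

noncomputable instance : MonoidalCategoryStruct (HBimod.{u} k H) where
  tensorObj := tensor
  whiskerLeft X _ _ f := tensorHom (𝟙 X) f
  whiskerRight f Y := tensorHom f (𝟙 Y)
  tensorHom f g := tensorHom f g
  tensorUnit := unit k H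
  associator X Y Z := mkIso (TensorProduct.assoc k X.V Y.V Z.V)
    (assoc_tensorAct X.lact Y.lact Z.lact) (assoc_tensorAct X.ract Y.ract Z.ract)
  leftUnitor X := mkIso (TensorProduct.lid k X.V) (lid_tensorAct X.lact) (lid_tensorAct X.ract)
  rightUnitor X := mkIso (TensorProduct.rid k X.V) (rid_tensorAct X.lact) (rid_tensorAct X.ract)

open MonoidalCategory

noncomputable instance : MonoidalCategory (HBimod.{u} k H) :=
  MonoidalCategory.ofTensorHom
    (id_tensorHom_id := fun _ _ => hom_ext TensorProduct.map_id)
    (id_tensorHom := fun _ _ _ _ => rfl)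
    (tensorHom_id := fun _ _ => rfl)
    (tensorHom_comp_tensorHom := fun _ _ _ _ => hom_ext (TensorProduct.map_comp _ _ _ _).symm)
    (associator_naturality := fun _ _ _ => hom_ext (TensorProduct.ext_threefold fun _ _ _ => rfl))
    (leftUnitor_naturality := fun f => hom_ext (TensorProduct.ext' fun a x =>
      (f.lin.map_smul a x).symm))
    (rightUnitor_naturality := fun f => hom_ext (TensorProduct.ext' fun x a =>
      (f.lin.map_smul a x).symm))
    (pentagon := fun _ _ _ _ => hom_ext (TensorProduct.ext_fourfold fun _ _ _ _ => rfl))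
    (triangle := fun _ _ => hom_ext (TensorProduct.ext_threefold fun x a y =>
      (TensorProduct.smul_tmul (R := k) (show k from a) x y).symm))

section Duality

open HopfAlgebra QuasitriangularHopf

lemma dualAct_one {V : Type u} [AddCommGroup V] [Module k V] {T : H →ₗ[k] H}
    {ρ : H →ₗ[k] V →ₗ[k] V} (hT : T 1 = 1) (hρ : ρ 1 = LinearMap.id) :
    dualAct T ρ 1 = LinearMap.id := by
  ext φ v; simp [hT, hρ]

lemma lift_antipode_left (X : HBimod.{u} k H) (h : H) :
    TensorProduct.lift ((LinearMap.llcomp k X.V X.V X.V).compl₁₂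
      (X.lact ∘ₗ antipode k) X.lact) (Coalgebra.comul h) =
      Coalgebra.counit (R := k) h • LinearMap.id := by
  have : ∀ s : H ⊗[k] H, TensorProduct.lift ((LinearMap.llcomp k X.V X.V X.V).compl₁₂
      (X.lact ∘ₗ antipode k) X.lact) s =
      X.lact (LinearMap.mul' k H ((antipode k).rTensor H s)) := by
    intro s
    induction s with
    | zero => simp
    | add a b ha hb => simp only [map_add, ha, hb]
    | tmul a b => ext v; simp [X.lact_mul]
  rw [this, mul_antipode_rTensor_comul_apply, Algebra.algebraMap_eq_smul_one, map_smul, X.lact_one]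

lemma lift_antipode_right (X : HBimod.{u} k H) (h : H) :
    TensorProduct.lift ((LinearMap.llcomp k X.V X.V X.V).compl₁₂
      X.lact (X.lact ∘ₗ antipode k)) (Coalgebra.comul h) =
      Coalgebra.counit (R := k) h • LinearMap.id := by
  have : ∀ s : H ⊗[k] H, TensorProduct.lift ((LinearMap.llcomp k X.V X.V X.V).compl₁₂
      X.lact (X.lact ∘ₗ antipode k)) s =
      X.lact (LinearMap.mul' k H ((antipode k).lTensor H s)) := by
    intro s
    induction s with
    | zero => simp
    | add a b ha hb => simp only [map_add, ha, hb]
    | tmul a b => ext v; simp [X.lact_mul]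
  rw [this, mul_antipode_lTensor_comul_apply, Algebra.algebraMap_eq_smul_one, map_smul, X.lact_one]

variable [FiniteDimensional k H] [QuasitriangularHopf k H]

lemma lift_antipode_symm_left (X : HBimod.{u} k H) (h : H) :
    TensorProduct.lift ((LinearMap.llcomp k X.V X.V X.V).compl₁₂
      (X.ract ∘ₗ (antipodeEquiv k H).symm.toLinearMap) X.ract) (Coalgebra.comul h) =
      Coalgebra.counit (R := k) h • LinearMap.id := by
  have : ∀ s : H ⊗[k] H, TensorProduct.lift ((LinearMap.llcomp k X.V X.V X.V).compl₁₂
      (X.ract ∘ₗ (antipodeEquiv k H).symm.toLinearMap) X.ract) s =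
      X.ract ((antipodeEquiv k H).symm (LinearMap.mul' k H ((antipode k).lTensor H s))) := by
    intro s
    induction s with
    | zero => simp
    | add a b ha hb => simp only [map_add, ha, hb]
    | tmul a b =>
      ext v
      simp [antipodeEquiv_symm_mul, X.ract_mul]
  rw [this, mul_antipode_lTensor_comul_apply, Algebra.algebraMap_eq_smul_one, map_smul,
    antipodeEquiv_symm_one, map_smul, X.ract_one]

lemma lift_antipode_symm_right (X : HBimod.{u} k H) (h : H) :
    TensorProduct.lift ((LinearMap.llcomp k X.V X.V X.V).compl₁₂
      X.ract (X.ract ∘ₗ (antipodeEquiv k H).symm.toLinearMap)) (Coalgebra.comul h) =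
      Coalgebra.counit (R := k) h • LinearMap.id := by
  have : ∀ s : H ⊗[k] H, TensorProduct.lift ((LinearMap.llcomp k X.V X.V X.V).compl₁₂
      X.ract (X.ract ∘ₗ (antipodeEquiv k H).symm.toLinearMap)) s =
      X.ract ((antipodeEquiv k H).symm (LinearMap.mul' k H ((antipode k).rTensor H s))) := by
    intro s
    induction s with
    | zero => simp
    | add a b ha hb => simp only [map_add, ha, hb]
    | tmul a b =>
      ext v
      simp [antipodeEquiv_symm_mul, X.ract_mul]
  rw [this, mul_antipode_rTensor_comul_apply, Algebra.algebraMap_eq_smul_one, map_smul,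
    antipodeEquiv_symm_one, map_smul, X.ract_one]

/-- The right dual `X^∨` of a bimodule `X`: the dual vector space `X*` with
`(h · φ)(x) = φ(S(h) · x)` and `(φ · h)(x) = φ(x · S⁻¹(h))`. -/
@[simps lact ract]
noncomputable def dual (X : HBimod.{u} k H) : HBimod.{u} k H where
  V := Module.Dual k X.V
  lact := dualAct (antipode k) X.lact
  ract := dualAct (antipodeEquiv k H).symm.toLinearMap X.ract
  lact_one := dualAct_one (by simp) X.lact_one
  lact_mul g h := by ext φ x; simp [antipode_mul_antidistrib, X.lact_mul]
  ract_one := dualAct_one antipodeEquiv_symm_one X.ract_one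
  ract_mul g h := by ext φ x; simp [antipodeEquiv_symm_mul, X.ract_mul]
  lact_ract g h := by
    ext φ x
    simpa using congrArg φ (LinearMap.congr_fun (X.lact_ract _ _).symm x)

/-- The evaluation `X^∨ ⊗ X ⟶ 𝟙`, `φ ⊗ x ↦ φ(x)`. -/
noncomputable def ev (X : HBimod.{u} k H) : X.dual ⊗ X ⟶ 𝟙_ (HBimod.{u} k H) :=
  ⟨contractLeft k X.V, contractLeft_tensorAct _ _ X.lift_antipode_left,
    contractLeft_tensorAct _ _ X.lift_antipode_symm_left⟩

/-- The coevaluation `𝟙 ⟶ X ⊗ X^∨`, `1 ↦ ∑ eᵢ ⊗ eⁱ`. -/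
noncomputable def coev (X : HBimod.{u} k H) : 𝟙_ (HBimod.{u} k H) ⟶ X ⊗ X.dual :=
  ⟨coevaluation k X.V, tensorAct_coevaluation _ _ X.lift_antipode_right,
    tensorAct_coevaluation _ _ X.lift_antipode_symm_right⟩

noncomputable instance (X : HBimod.{u} k H) : ExactPairing X X.dual where
  coevaluation' := X.coev
  evaluation' := X.ev
  coevaluation_evaluation' := hom_ext (contractLeft_assoc_coevaluation k X.V)
  evaluation_coevaluation' := hom_ext (contractLeft_assoc_coevaluation' k X.V)

noncomputable instance : RightRigidCategory (HBimod.{u} k H) where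
  rightDual X := { rightDual := X.dual }

end Duality

section Coadjoint

open HopfAlgebra QuasitriangularHopf

/-- `a ⊗ b` is sent to the linear map `x ↦ a x b`. -/
noncomputable def sandwich (k H : Type u) [Field k] [Ring H] [HopfAlgebra k H] :
    H ⊗[k] H →ₗ[k] H →ₗ[k] H :=
  TensorProduct.lift ((LinearMap.llcomp k H H H).compl₁₂ (LinearMap.mul k H)
    (LinearMap.mul k H).flip)

@[simp] lemma sandwich_tmul (a b x : H) : sandwich k H (a ⊗ₜ b) x = a * (x * b) := rfl

/-- `h` is sent to `x ↦ ∑ S(h₍₁₎) x h₍₂₎`. -/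
noncomputable def adLeft (k H : Type u) [Field k] [Ring H] [HopfAlgebra k H] :
    H →ₗ[k] H →ₗ[k] H :=
  sandwich k H ∘ₗ (antipode k).rTensor H ∘ₗ Coalgebra.comul

lemma adLeft_one : adLeft k H 1 = LinearMap.id := by
  ext x; simp [adLeft, Algebra.TensorProduct.one_def]

lemma adLeft_mul (g h : H) : adLeft k H (g * h) = adLeft k H h ∘ₗ adLeft k H g := by
  have : ∀ s t : H ⊗[k] H, sandwich k H ((antipode k).rTensor H (s * t)) =
      sandwich k H ((antipode k).rTensor H t) ∘ₗ sandwich k H ((antipode k).rTensor H s) := by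
    intro s t
    induction s with
    | zero => simp
    | add a b ha hb => simp only [map_add, add_mul, ha, hb, LinearMap.comp_add]
    | tmul a b =>
      induction t with
      | zero => simp
      | add x y hx hy => simp only [map_add, mul_add, hx, hy, LinearMap.add_comp]
      | tmul x y => ext z; simp [antipode_mul_antidistrib, mul_assoc]
  simp [adLeft, Bialgebra.comul_mul, this]

variable [FiniteDimensional k H] [QuasitriangularHopf k H]

/-- `h` is sent to `x ↦ ∑ h₍₂₎ x S⁻¹(h₍₁₎)`, which is `x ↦ ∑ S(g₍₁₎) x g₍₂₎` for
`g = S⁻¹(h)`. -/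
noncomputable def adRight (k H : Type u) [Field k] [Ring H] [HopfAlgebra k H]
    [FiniteDimensional k H] [QuasitriangularHopf k H] : H →ₗ[k] H →ₗ[k] H :=
  sandwich k H ∘ₗ (TensorProduct.comm k H H).toLinearMap ∘ₗ
    (antipodeEquiv k H).symm.toLinearMap.rTensor H ∘ₗ Coalgebra.comul

lemma adRight_one : adRight k H 1 = LinearMap.id := by
  ext x; simp [adRight, Algebra.TensorProduct.one_def, antipodeEquiv_symm_one]

lemma adRight_mul (g h : H) : adRight k H (g * h) = adRight k H g ∘ₗ adRight k H h := by
  let F : H ⊗[k] H →ₗ[k] H →ₗ[k] H := sandwich k H ∘ₗ (TensorProduct.comm k H H).toLinearMap ∘ₗ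
    (antipodeEquiv k H).symm.toLinearMap.rTensor H
  have : ∀ s t : H ⊗[k] H, F (s * t) = F s ∘ₗ F t := by
    intro s t
    induction s with
    | zero => simp
    | add a b ha hb => simp only [map_add, add_mul, ha, hb, LinearMap.add_comp]
    | tmul a b =>
      induction t with
      | zero => simp
      | add x y hx hy => simp only [map_add, mul_add, hx, hy, LinearMap.comp_add]
      | tmul x y => ext z; simp [F, antipodeEquiv_symm_mul, mul_assoc]
  have h2 : ∀ a, adRight k H a = F (Coalgebra.comul a) := fun _ => rfl
  simp [h2, Bialgebra.comul_mul, this]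

/-- The coadjoint left action on `H*`: `(h ▷ p)(x) = ∑ p(S(h₍₁₎) x h₍₂₎)`. -/
noncomputable def coadLeft (k H : Type u) [Field k] [Ring H] [HopfAlgebra k H] :
    H →ₗ[k] Module.Dual k H →ₗ[k] Module.Dual k H :=
  dualAct LinearMap.id (adLeft k H)

/-- The coadjoint right action on `H*`: `(p ◁ h)(x) = ∑ p(h₍₂₎ x S⁻¹(h₍₁₎))`. -/
noncomputable def coadRight (k H : Type u) [Field k] [Ring H] [HopfAlgebra k H]
    [FiniteDimensional k H] [QuasitriangularHopf k H] :
    H →ₗ[k] Module.Dual k H →ₗ[k] Module.Dual k H :=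
  dualAct LinearMap.id (adRight k H)

/-- The coadjoint bimodule: `H* ⊗ H*` with the coadjoint left action on the first tensor factor
and the coadjoint right action on the second tensor factor. -/
noncomputable def coadjoint (k H : Type u) [Field k] [Ring H] [HopfAlgebra k H]
    [FiniteDimensional k H] [QuasitriangularHopf k H] : HBimod.{u} k H where
  V := Module.Dual k H ⊗[k] Module.Dual k H
  lact := LinearMap.rTensorHom (Module.Dual k H) ∘ₗ coadLeft k H
  ract := LinearMap.lTensorHom (Module.Dual k H) ∘ₗ coadRight k H
  lact_one := by ext : 3; simp [coadLeft, adLeft_one]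
  lact_mul g h := by
    ext p q : 3
    simp [coadLeft, adLeft_mul, LinearMap.comp_assoc]
  ract_one := by ext : 3; simp [coadRight, adRight_one]
  ract_mul g h := by
    ext p q : 3
    simp [coadRight, adRight_mul, LinearMap.comp_assoc]
  lact_ract g h := by ext p q : 3; simp

end Coadjoint

section DinaturalFamily

/-- `a ⊗ b` is sent to `x ↦ a · x · b`. -/
noncomputable def biact (X : HBimod.{u} k H) : H ⊗[k] H →ₗ[k] X.V →ₗ[k] X.V :=
  TensorProduct.lift ((LinearMap.llcomp k X.V X.V X.V).compl₁₂ X.lact X.ract)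

/-- The linear map `X* ⊗ X → H* ⊗ H*` that sends `φ ⊗ x` to the unique element of `H* ⊗ H*`
whose value on `a ⊗ b` is `φ(a · x · b)`, that is, to `∑ φ(eᵢ · x · eⱼ) eⁱ ⊗ eʲ`. -/
noncomputable def dinatLin [FiniteDimensional k H] (X : HBimod.{u} k H) :
    Module.Dual k X.V ⊗[k] X.V →ₗ[k] Module.Dual k H ⊗[k] Module.Dual k H :=
  (TensorProduct.dualDistribEquiv k H H).symm.toLinearMap ∘ₗ
    TensorProduct.lift ((LinearMap.llcomp k (H ⊗[k] H) X.V k).compl₁₂ LinearMap.id X.biact.flip)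

lemma dualDistrib_dinatLin [FiniteDimensional k H] (X : HBimod.{u} k H) (φ : Module.Dual k X.V) (x : X.V) (a b : H) :
    TensorProduct.dualDistrib k H H (X.dinatLin (φ ⊗ₜ[k] x)) (a ⊗ₜ[k] b) =
      φ (X.lact a (X.ract b x)) := by
  have : ∀ t, TensorProduct.dualDistrib k H H ((TensorProduct.dualDistribEquiv k H H).symm t) = t :=
    fun t => (TensorProduct.dualDistribEquiv k H H).apply_symm_apply t
  change TensorProduct.dualDistrib k H H ((TensorProduct.dualDistribEquiv k H H).symm
    (φ ∘ₗ X.biact.flip x)) (a ⊗ₜ[k] b) = _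
  rw [this]
  rfl

end DinaturalFamily

end HBimod

section

open MonoidalCategory

/-- The functor `Cᵒᵖ × C ⥤ C`, `(X, Y) ↦ X^∨ ⊗ Y`, `(f, g) ↦ f^∨ ⊗ g`, of a category with right
duals. -/
def rightDualTensor (C : Type*) [Category C] [MonoidalCategory C] [RightRigidCategory C] :
    Cᵒᵖ ⥤ C ⥤ C where
  obj X := tensorLeft (X.unop)ᘁ
  map f := (curriedTensor C).map (rightAdjointMate f.unop)
  map_id X := by simp
  map_comp f g := by simp [comp_rightAdjointMate]

end

/-! Write `F` for the free bimodule `H ⊗ H` and `u = 1 ⊗ 1` for its generator. `F` is itself an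
object of the category because `H` is finite-dimensional, and it generates: each `x` in `X` is
`f(u)` for the orbit map `f : F ⟶ X`, `a ⊗ b ↦ a · x · b`. Dinaturality along `f` therefore gives
`s_X(φ ⊗ x) = s_F((φ ∘ f) ⊗ u)` for every dinatural family `s`, so that `s` is determined by its
component at `F`, restricted to `F* ⊗ u`. Under `H* ⊗ H* ≅ (H ⊗ H)*` the element `i_X(φ ⊗ x)` is
precisely `φ ∘ f`. Hence `p ↦ p ⊗ u` is a linear section of `i_F` (`dinatLin_freeSection`), and its
composite with `s_F` is a linear map on `K` that factors every `s_X` through `i_X`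
(`freeSection_dinatLin`, `descLin_dinatLin`). The section need not respect the actions, but the
induced map does: `i_F` is a surjective bimodule morphism and the composite with it is the morphism
`s_F` (`descOfFree`). Surjectivity of `i_F` also gives uniqueness (`coadjoint_hom_ext`). That each
`i_X` is a bimodule morphism amounts to `φ(S(h₍₁₎) a · x · b) = ∑ (h ▷ -)` read on arguments: the
action on `X^∨ ⊗ X` turns `a` into `∑ S(h₍₁₎) a h₍₂₎` on the left, and `b` into `∑ h₍₂₎ b S⁻¹(h₍₁₎)`
on the right. -/

namespace HBimod

open MonoidalCategory HopfAlgebra QuasitriangularHopf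

variable {k H : Type u} [Field k] [Ring H] [HopfAlgebra k H]

/-! ### The two-sided action map `a ⊗ b ↦ a · x · b` -/

lemma biact_tmul (X : HBimod.{u} k H) (a b : H) (x : X.V) :
    X.biact (a ⊗ₜ[k] b) x = X.lact a (X.ract b x) := rfl

lemma lact_mul_apply (X : HBimod.{u} k H) (g h : H) (x : X.V) :
    X.lact (g * h) x = X.lact g (X.lact h x) := LinearMap.congr_fun (X.lact_mul g h) x

lemma ract_mul_apply (X : HBimod.{u} k H) (g h : H) (x : X.V) :
    X.ract (g * h) x = X.ract h (X.ract g x) := LinearMap.congr_fun (X.ract_mul g h) x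

lemma lact_ract_apply (X : HBimod.{u} k H) (g h : H) (x : X.V) :
    X.lact g (X.ract h x) = X.ract h (X.lact g x) := LinearMap.congr_fun (X.lact_ract g h) x

/-- This commutation with morphisms is the whole content of the dinaturality of `i`. -/
lemma biact_lin {X Y : HBimod.{u} k H} (f : X ⟶ Y) (s : H ⊗[k] H) (x : X.V) :
    Y.biact s (f.lin x) = f.lin (X.biact s x) := by
  induction s with
  | zero => simp
  | add a b ha hb => simp only [map_add, LinearMap.add_apply, ha, hb]
  | tmul a b =>
    have hl := LinearMap.congr_fun (f.lin_lact a) (X.ract b x)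
    have hr := LinearMap.congr_fun (f.lin_ract b) x
    simp only [LinearMap.comp_apply] at hl hr
    simp only [biact_tmul, hl, hr]

/-- With its right-handed counterpart below, this makes the orbit map of `x` a morphism out of the
free bimodule. -/
lemma biact_rTensor (X : HBimod.{u} k H) (h : H) (s : H ⊗[k] H) (x : X.V) :
    X.biact ((LinearMap.mul k H h).rTensor H s) x = X.lact h (X.biact s x) := by
  induction s with
  | zero => simp
  | add a b ha hb => simp only [map_add, LinearMap.add_apply, ha, hb]
  | tmul a b => simp [biact_tmul, lact_mul_apply]

lemma biact_lTensor (X : HBimod.{u} k H) (h : H) (s : H ⊗[k] H) (x : X.V) :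
    X.biact (((LinearMap.mul k H).flip h).lTensor H s) x = X.ract h (X.biact s x) := by
  induction s with
  | zero => simp
  | add a b ha hb => simp only [map_add, LinearMap.add_apply, ha, hb]
  | tmul a b => simp [biact_tmul, ract_mul_apply, lact_ract_apply]

/-! ### The free bimodule on one generator -/

/-- The free bimodule `H ⊗ H` on one generator, with `a · (x ⊗ y) · b = a x ⊗ y b`. -/
noncomputable def free (k H : Type u) [Field k] [Ring H] [HopfAlgebra k H]
    [FiniteDimensional k H] : HBimod.{u} k H where
  V := H ⊗[k] H
  lact := LinearMap.rTensorHom H ∘ₗ LinearMap.mul k H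
  ract := LinearMap.lTensorHom H ∘ₗ (LinearMap.mul k H).flip
  lact_one := by ext : 3; simp
  lact_mul g h := by ext : 3; simp [mul_assoc]
  ract_one := by ext : 3; simp
  ract_mul g h := by ext : 3; simp [mul_assoc]
  lact_ract g h := by ext : 3; simp

/-- The morphism from the free bimodule that sends the generator to `x`. -/
noncomputable def freeLift [FiniteDimensional k H] (X : HBimod.{u} k H) (x : X.V) :
    free k H ⟶ X :=
  ⟨X.biact.flip x, fun h => LinearMap.ext fun s => X.biact_rTensor h s x,
    fun h => LinearMap.ext fun s => X.biact_lTensor h s x⟩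

/-- The generator `1 ⊗ 1` of the free bimodule. -/
noncomputable def freeOne (k H : Type u) [Field k] [Ring H] [HopfAlgebra k H]
    [FiniteDimensional k H] : (free k H).V :=
  (1 : H) ⊗ₜ[k] (1 : H)

lemma freeLift_freeOne [FiniteDimensional k H] (X : HBimod.{u} k H) (x : X.V) :
    (freeLift X x).lin (freeOne k H) = x := by
  change X.lact 1 (X.ract 1 x) = x
  simp [X.lact_one, X.ract_one]

/-- The orbit map of the generator is the identity, so pairing with the generator loses no
information about a functional on the free bimodule. -/
lemma biact_freeOne [FiniteDimensional k H] (s : H ⊗[k] H) :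
    (free k H).biact s (freeOne k H) = s := by
  refine LinearMap.congr_fun (f := (free k H).biact.flip (freeOne k H)) (g := LinearMap.id)
    (TensorProduct.ext' fun a b => ?_) s
  change (a * 1) ⊗ₜ[k] (1 * b) = a ⊗ₜ[k] b
  rw [mul_one, one_mul]

/-! ### Elements of `K` as functionals on `H ⊗ H`, and compatibility with the left action -/

section Dinatural

lemma dualDistrib_coadLeft (h : H) (t : Module.Dual k H ⊗[k] Module.Dual k H) (a b : H) :
    TensorProduct.dualDistrib k H H ((coadLeft k H h).rTensor _ t) (a ⊗ₜ[k] b) =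
      TensorProduct.dualDistrib k H H t (adLeft k H h a ⊗ₜ[k] b) := by
  induction t with
  | zero => simp
  | add x y hx hy => simp only [map_add, LinearMap.add_apply, hx, hy]
  | tmul p q => simp [coadLeft]

variable [FiniteDimensional k H]

/-- Since `H` is finite-dimensional, `H* ⊗ H*` is all of `(H ⊗ H)*`; equalities in `K` are checked
as equalities of functionals. -/
lemma dualDistrib_injective : Function.Injective (TensorProduct.dualDistrib k H H) :=
  (TensorProduct.dualDistribEquiv k H H).injective

lemma dualDistrib_dinatLin_apply (X : HBimod.{u} k H) (φ : Module.Dual k X.V) (x : X.V)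
    (s : H ⊗[k] H) :
    TensorProduct.dualDistrib k H H (X.dinatLin (φ ⊗ₜ[k] x)) s = φ (X.biact s x) := by
  induction s with
  | zero => simp
  | add a b ha hb => simp only [map_add, LinearMap.add_apply, ha, hb]
  | tmul a b => exact dualDistrib_dinatLin X φ x a b

/-- An element of `H* ⊗ H*`, as a functional on the free bimodule, tensor the generator. -/
noncomputable def freeSection (k H : Type u) [Field k] [Ring H] [HopfAlgebra k H]
    [FiniteDimensional k H] :
    Module.Dual k H ⊗[k] Module.Dual k H →ₗ[k] Module.Dual k (free k H).V ⊗[k] (free k H).V :=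
  (TensorProduct.mk k (Module.Dual k (free k H).V) (free k H).V).flip (freeOne k H) ∘ₗ
    TensorProduct.dualDistrib k H H

/-- A functional `p` paired with the generator is sent to `s ↦ p(s · u) = p(s)`. In particular the
component at the free bimodule is surjective. -/
lemma dinatLin_freeSection (t : Module.Dual k H ⊗[k] Module.Dual k H) :
    (free k H).dinatLin (freeSection k H t) = t := by
  apply dualDistrib_injective
  apply LinearMap.ext
  intro s
  refine (dualDistrib_dinatLin_apply (free k H) (TensorProduct.dualDistrib k H H t)
    (freeOne k H) s).trans ?_
  exact congrArg (TensorProduct.dualDistrib k H H t) (biact_freeOne s)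

/-- The functional `a ⊗ b ↦ φ(a · x · b)` is `φ` pulled back along the orbit map of `x`. The result
is one of the two sides that dinaturality along this map equates. -/
lemma freeSection_dinatLin (X : HBimod.{u} k H) (φ : Module.Dual k X.V) (x : X.V) :
    freeSection k H (X.dinatLin (φ ⊗ₜ[k] x)) =
      (φ ∘ₗ (freeLift X x).lin) ⊗ₜ[k] freeOne k H := by
  have : TensorProduct.dualDistrib k H H (X.dinatLin (φ ⊗ₜ[k] x)) = φ ∘ₗ (freeLift X x).lin :=
    LinearMap.ext fun t => dualDistrib_dinatLin_apply X φ x t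
  exact congrArg (fun ψ : Module.Dual k (free k H).V => ψ ⊗ₜ[k] freeOne k H) this

lemma dinatLin_lact (X : HBimod.{u} k H) (h : H) :
    X.dinatLin ∘ₗ tensorAct (dualAct (antipode k) X.lact) X.lact h =
      (coadLeft k H h).rTensor _ ∘ₗ X.dinatLin := by
  apply TensorProduct.ext'
  intro φ x
  apply dualDistrib_injective
  apply TensorProduct.ext'
  intro a b
  -- The coproduct plays no role here: the identity holds for any `s` in place of `Δ(h)`. On `c ⊗ d`
  -- both sides are `φ(S(c) a d · x · b)`, since the left action of `d` commutes with the right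
  -- action of `b`.
  have key : ∀ s : H ⊗[k] H, TensorProduct.dualDistrib k H H
      (X.dinatLin (tensorAct₂ (dualAct (antipode k) X.lact) X.lact s (φ ⊗ₜ[k] x))) (a ⊗ₜ[k] b) =
      φ (X.lact (sandwich k H ((antipode k).rTensor H s) a) (X.ract b x)) := by
    intro s
    induction s with
    | zero => simp
    | add c d hc hd => simp only [map_add, LinearMap.add_apply, hc, hd]
    | tmul c d => simp [dualDistrib_dinatLin, lact_mul_apply, lact_ract_apply]
  rw [LinearMap.comp_apply, LinearMap.comp_apply, dualDistrib_coadLeft, dualDistrib_dinatLin]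
  exact key (Coalgebra.comul h)

/-! ### Compatibility with the right action, and dinaturality -/

variable [QuasitriangularHopf k H]

lemma dualDistrib_coadRight (h : H) (t : Module.Dual k H ⊗[k] Module.Dual k H) (a b : H) :
    TensorProduct.dualDistrib k H H ((coadRight k H h).lTensor _ t) (a ⊗ₜ[k] b) =
      TensorProduct.dualDistrib k H H t (a ⊗ₜ[k] adRight k H h b) := by
  induction t with
  | zero => simp
  | add x y hx hy => simp only [map_add, LinearMap.add_apply, hx, hy]
  | tmul p q => simp [coadRight]

lemma dinatLin_ract (X : HBimod.{u} k H) (h : H) :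
    X.dinatLin ∘ₗ tensorAct (dualAct (antipodeEquiv k H).symm.toLinearMap X.ract) X.ract h =
      (coadRight k H h).lTensor _ ∘ₗ X.dinatLin := by
  apply TensorProduct.ext'
  intro φ x
  apply dualDistrib_injective
  apply TensorProduct.ext'
  intro a b
  -- On `c ⊗ d` both sides are `φ(a · x · d b S⁻¹(c))`. The factor `d` acts on `x` before `b`, and
  -- `S⁻¹(c)` acts last, which accounts for the flip of the tensor factors.
  have key : ∀ s : H ⊗[k] H, TensorProduct.dualDistrib k H H
      (X.dinatLin (tensorAct₂ (dualAct (antipodeEquiv k H).symm.toLinearMap X.ract) X.ract s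
        (φ ⊗ₜ[k] x))) (a ⊗ₜ[k] b) =
      φ (X.lact a (X.ract (sandwich k H (TensorProduct.comm k H H
        ((antipodeEquiv k H).symm.toLinearMap.rTensor H s)) b) x)) := by
    intro s
    induction s with
    | zero => simp
    | add c d hc hd => simp only [map_add, LinearMap.add_apply, hc, hd]
    | tmul c d => simp [dualDistrib_dinatLin, ract_mul_apply, lact_ract_apply]
  rw [LinearMap.comp_apply, LinearMap.comp_apply, dualDistrib_coadRight, dualDistrib_dinatLin]
  exact key (Coalgebra.comul h)

/-- The component at `X` of the dinatural family `X^∨ ⊗ X ⟶ K`. -/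
noncomputable def dinat (X : HBimod.{u} k H) : X.dual ⊗ X ⟶ coadjoint k H :=
  ⟨X.dinatLin, X.dinatLin_lact, X.dinatLin_ract⟩

/-- The mate is characterised by its compatibility with evaluation, and evaluation is the pairing of
vector spaces; hence it is the transpose, with no computation of coevaluations. -/
lemma rightAdjointMate_lin {X Y : HBimod.{u} k H} (f : X ⟶ Y) (φ : Module.Dual k Y.V) :
    Hom.lin (rightAdjointMate f) φ = φ ∘ₗ f.lin := by
  apply LinearMap.ext
  intro x
  exact LinearMap.congr_fun (congrArg Hom.lin (rightAdjointMate_comp_evaluation f)) (φ ⊗ₜ[k] x)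

/-- Dinaturality of a family `X^∨ ⊗ X ⟶ Z` on elements. -/
lemma dinatural_iff {Z : HBimod.{u} k H} {X Y : HBimod.{u} k H} (f : X ⟶ Y)
    (s : X.dual ⊗ X ⟶ Z) (t : Y.dual ⊗ Y ⟶ Z) :
    ((rightDualTensor (HBimod.{u} k H)).map f.op).app X ≫ s =
        ((rightDualTensor (HBimod.{u} k H)).obj (Opposite.op Y)).map f ≫ t ↔
      ∀ (φ : Module.Dual k Y.V) (x : X.V),
        s.lin ((φ ∘ₗ f.lin) ⊗ₜ[k] x) = t.lin (φ ⊗ₜ[k] f.lin x) := by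
  have h1 (φ : Module.Dual k Y.V) (x : X.V) :
      Hom.lin (((rightDualTensor (HBimod.{u} k H)).map f.op).app X ≫ s) (φ ⊗ₜ[k] x) =
        s.lin ((φ ∘ₗ f.lin) ⊗ₜ[k] x) := by
    rw [← rightAdjointMate_lin]
    rfl
  constructor
  · intro e φ x
    rw [← h1, e]
    rfl
  · intro e
    apply hom_ext
    apply TensorProduct.ext'
    intro φ x
    exact (h1 φ x).trans (e φ x)

lemma dinat_dinatural ⦃X Y : HBimod.{u} k H⦄ (f : X ⟶ Y) :
    ((rightDualTensor (HBimod.{u} k H)).map f.op).app X ≫ X.dinat =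
      ((rightDualTensor (HBimod.{u} k H)).obj (Opposite.op Y)).map f ≫ Y.dinat := by
  refine (dinatural_iff f X.dinat Y.dinat).2 fun φ x => ?_
  apply dualDistrib_injective
  apply LinearMap.ext
  intro s
  -- The two values at `s` are `φ(f(s · x))` and `φ(s · f(x))`.
  refine (dualDistrib_dinatLin_apply X _ _ _).trans
    (Eq.trans ?_ (dualDistrib_dinatLin_apply Y _ _ _).symm)
  rw [biact_lin, LinearMap.comp_apply]

/-! ### The universal property -/

variable {Z : HBimod.{u} k H}

/-- A linear map on `K` whose composite with the surjection `(free k H).dinat` is a morphism is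
itself a morphism. -/
noncomputable def descOfFree (l : Module.Dual k H ⊗[k] Module.Dual k H →ₗ[k] Z.V)
    (s : (free k H).dual ⊗ free k H ⟶ Z) (hl : ∀ t, l ((free k H).dinatLin t) = s.lin t) :
    coadjoint k H ⟶ Z :=
  ⟨l, fun h => LinearMap.ext fun t => by
      obtain ⟨w, rfl⟩ : ∃ w, (free k H).dinat.lin w = t := ⟨_, dinatLin_freeSection t⟩
      -- With `t = i_F(w)`: `l(h · i_F(w)) = l(i_F(h · w)) = s(h · w) = h · s(w) = h · l(i_F(w))`.
      -- The right action is treated in the same way.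
      exact (congrArg l (LinearMap.congr_fun ((free k H).dinat.lin_lact h) w).symm).trans
        ((hl _).trans ((LinearMap.congr_fun (s.lin_lact h) w).trans
          (congrArg (Z.lact h) (hl w).symm))),
    fun h => LinearMap.ext fun t => by
      obtain ⟨w, rfl⟩ : ∃ w, (free k H).dinat.lin w = t := ⟨_, dinatLin_freeSection t⟩
      exact (congrArg l (LinearMap.congr_fun ((free k H).dinat.lin_ract h) w).symm).trans
        ((hl _).trans ((LinearMap.congr_fun (s.lin_ract h) w).trans
          (congrArg (Z.ract h) (hl w).symm)))⟩

variable (s : ∀ X : HBimod.{u} k H, X.dual ⊗ X ⟶ Z)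

/-- The linear map `K → Z` induced by a family `X^∨ ⊗ X ⟶ Z`. -/
noncomputable def descLin : Module.Dual k H ⊗[k] Module.Dual k H →ₗ[k] Z.V :=
  (s (free k H)).lin ∘ₗ freeSection k H

variable {s} in
lemma descLin_dinatLin
    (hs : ∀ ⦃X Y : HBimod.{u} k H⦄ (f : X ⟶ Y),
      ((rightDualTensor (HBimod.{u} k H)).map f.op).app X ≫ s X =
        ((rightDualTensor (HBimod.{u} k H)).obj (Opposite.op Y)).map f ≫ s Y)
    (X : HBimod.{u} k H) (t : Module.Dual k X.V ⊗[k] X.V) :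
    descLin s (X.dinatLin t) = (s X).lin t := by
  refine LinearMap.congr_fun (f := descLin s ∘ₗ X.dinatLin) (g := (s X).lin)
    (TensorProduct.ext' fun φ x => ?_) t
  -- Dinaturality along the orbit map of `x`, evaluated at `φ ⊗ u`; the orbit map sends `u` to `x`,
  -- so the side at `X` becomes `s_X(φ ⊗ x)`.
  have h := (dinatural_iff _ _ _).1 (hs (freeLift X x)) φ (freeOne k H)
  rw [freeLift_freeOne] at h
  exact (congrArg (s (free k H)).lin (freeSection_dinatLin X φ x)).trans h

variable (hs : ∀ ⦃X Y : HBimod.{u} k H⦄ (f : X ⟶ Y),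
    ((rightDualTensor (HBimod.{u} k H)).map f.op).app X ≫ s X =
      ((rightDualTensor (HBimod.{u} k H)).obj (Opposite.op Y)).map f ≫ s Y)

/-- The morphism `K ⟶ Z` induced by a dinatural family `X^∨ ⊗ X ⟶ Z`. -/
noncomputable def desc : coadjoint k H ⟶ Z :=
  descOfFree (descLin s) (s (free k H)) (descLin_dinatLin hs (free k H))

lemma dinat_desc (X : HBimod.{u} k H) : X.dinat ≫ desc s hs = s X :=
  hom_ext (LinearMap.ext (descLin_dinatLin hs X))

/-- The component at the free bimodule is surjective, hence epi, so this single component detects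
equality of morphisms out of `K`. -/
lemma coadjoint_hom_ext {f g : coadjoint k H ⟶ Z}
    (h : (free k H).dinat ≫ f = (free k H).dinat ≫ g) : f = g := by
  refine hom_ext (LinearMap.ext fun t => ?_)
  obtain ⟨w, rfl⟩ : ∃ w, (free k H).dinat.lin w = t := ⟨_, dinatLin_freeSection t⟩
  exact LinearMap.congr_fun (congrArg Hom.lin h) w

variable (k H) in
/-- The cowedge formed by the coadjoint bimodule and the dinatural family. -/
noncomputable def coadjointCowedge : Limits.Cowedge (rightDualTensor (HBimod.{u} k H)) :=
  Limits.Cowedge.mk (F := rightDualTensor (HBimod.{u} k H)) (coadjoint k H) dinat dinat_dinatural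

variable (k H) in
/-- The coadjoint bimodule is the coend of `(X, Y) ↦ X^∨ ⊗ Y`. -/
noncomputable def coadjointIsColimit : Limits.IsColimit (coadjointCowedge k H) :=
  Limits.Multicofork.IsColimit.mk _
    (fun c => desc c.π fun _ _ f => Limits.Cowedge.condition c f)
    (fun c X => dinat_desc c.π _ X)
    (fun c _ hm => coadjoint_hom_ext ((hm (free k H)).trans (dinat_desc c.π _ _).symm))

end Dinatural

end HBimod

/-! ### The coend theorem and comparison with an arbitrary coend -/

theorem mainTheorem8 {k H : Type u} [Field k] [Ring H] [HopfAlgebra k H]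
    [FiniteDimensional k H] [RibbonHopf k H] :
    ∃ (i : ∀ X : HBimod.{u} k H,
        ((rightDualTensor (HBimod.{u} k H)).obj (Opposite.op X)).obj X ⟶ HBimod.coadjoint k H)
      (hi : ∀ ⦃X Y : HBimod.{u} k H⦄ (f : X ⟶ Y),
        ((rightDualTensor (HBimod.{u} k H)).map f.op).app X ≫ i X =
          ((rightDualTensor (HBimod.{u} k H)).obj (Opposite.op Y)).map f ≫ i Y),
      (∀ X : HBimod.{u} k H, (i X).lin = X.dinatLin) ∧
      Nonempty (Limits.IsColimit (Limits.Cowedge.mk (F := rightDualTensor (HBimod.{u} k H))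
        (HBimod.coadjoint k H) i hi)) ∧
      ∀ c : Limits.Cowedge (rightDualTensor (HBimod.{u} k H)), Nonempty (Limits.IsColimit c) →
        ∃! e : HBimod.coadjoint k H ≅ c.pt, ∀ X : HBimod.{u} k H, i X ≫ e.hom = c.π X := by
  refine ⟨HBimod.dinat, HBimod.dinat_dinatural, fun _ => rfl, ⟨HBimod.coadjointIsColimit k H⟩, ?_⟩
  rintro c ⟨hc⟩
  refine ⟨(HBimod.coadjointIsColimit k H).coconePointUniqueUpToIso hc, fun X => ?_, ?_⟩
  -- A cowedge is a cocone on a multispan whose `right X` vertex carries `X^∨ ⊗ X`; the cocone leg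
  -- there is the component at `X`.
  · exact Limits.IsColimit.comp_coconePointUniqueUpToIso_hom (HBimod.coadjointIsColimit k H) hc
      (Limits.WalkingMultispan.right X)
  · intro e he
    -- An isomorphism is determined by its forward morphism, and the latter by its composite with
    -- the component at the free bimodule.
    ext1
    refine HBimod.coadjoint_hom_ext ((he (HBimod.free k H)).trans ?_)
    exact (Limits.IsColimit.comp_coconePointUniqueUpToIso_hom (HBimod.coadjointIsColimit k H) hc
      (Limits.WalkingMultispan.right (HBimod.free k H))).symm
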